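/- Let $X$ be a complex Banach space, $1<\alpha<2$, and let $A:D(A)\subset X\to X$ be a closed, densely defined linear operator satisfying: (H1) $A$ is sectorial of type $\omega<0$ and angle $\theta$ with constant $M>0$, where $0<\theta<\pi(1-\frac{\alpha}{2})$. That is, with $\omega+S_\theta=\{\omega+\lambda:\lambda\in\mathbb C,\ |\arg(-\lambda)|<\theta\}$ (vertex $\omega$ included), every $\lambda\notin\omega+S_\theta$ lies in the resolvent set of $A$ and $\|(\lambda-A)^{-1}\|\le M/|\lambda-\omega|$. Let $S_\alpha(0)=I$ and, for $t>0$, $$S_\alpha(t)=\frac1{2\pi i}\int_\gamma e^{\lambda t}\lambda^{\alpha-1}(\lambda^\alpha-A)^{-1}\,d\lambda ,$$ where $\gamma$ is the path that runs from $\infty e^{-i\varphi}$ straight to $0$ and then straight to $\infty e^{i\varphi}$, for any fixed $\varphi>\pi/2$ with $\alpha\varphi<\pi-\theta$. Assume: (H3) $(S_\alpha(t))_{t\ge0}$ is strongly continuous. Then there is a constant $C>0$ such that $$\|S_\alpha(t)\|\le\frac{CM}{1+|\omega|t^\alpha}\qquad(t\ge0),\tag{1}$$ and the following holds for every $C>0$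 satisfying (1). Definitions. A bounded continuous $u:\mathbb R\to X$ is almost automorphic if every real sequence has a subsequence $(s_n)$ such that $g(t)=\lim_n u(t+s_n)$ exists and $\lim_n g(t-s_n)=u(t)$ for each $t\in\mathbb R$. It is asymptotically almost automorphic if $u=u_1+u_2$ with $u_1$ almost automorphic and $u_2$ bounded, continuous and $u_2(t)\to0$ as $t\to+\infty$. A function $f:\mathbb R\times X\times X\to X$ is asymptotically almost automorphic if $f=f_1+f_2$, where $f_1,f_2$ are continuous and bounded on $\mathbb R\times B$ for every bounded $B\subset X\times X$, such that: for every compact $Q\subset X\times X$, every real sequence has a subsequence $(s_n)$ for which $g(t,y)=\lim_n f_1(t+s_n,y)$ exists and $\lim_n g(t-s_n,y)=f_1(t,y)$ for all $t\in\mathbb R$, $y\in Q$; and $f_2(t,y)\to0$ as $t\to+\infty$, uniformly for $y$ in bounded subsets of $X\times X$. Let $k\in L^1(\mathbb R^+)$ (scalar-valued), $Ku(t)=\int_{-\infty}^t k(t-s)u(s)\,ds$, and assume: (H2) $f$ is asymptotically almost automorphic and there is $L_f>0$ with $\|f(t,u,\phi)-f(t,v,\psi)\|\le L_f(\|u-v\|+\|\phi-\psi\|)$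 for all $t\in\mathbb R$ and $u,v,\phi,\psi\in X$. If $$\Lambda=\frac{CM|\omega|^{-1/\alpha}\pi}{\alpha\sin(\pi/\alpha)}\,L_f\,(1+\|k\|_{L^1(\mathbb R^+)})<1,$$ then the fractional integro-differential equation ${}^{C}D_t^{\alpha}u(t)=Au(t)+{}^{C}D_t^{\alpha-1}f(t,u(t),Ku(t))$, $t\in\mathbb R$, has exactly one asymptotically almost automorphic mild solution, that is, there is exactly one asymptotically almost automorphic $u:\mathbb R\to X$ such that for each $t\in\mathbb R$ the functions $s\mapsto k(t-s)u(s)$ and $s\mapsto S_\alpha(t-s)f(s,u(s),Ku(s))$ are integrable on $(-\infty,t)$ and $$u(t)=\int_{-\infty}^t S_\alpha(t-s)f(s,u(s),Ku(s))\,ds .$$ -/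

import Mathlib

open Set Filter Topology MeasureTheory

noncomputable section

/-! ### Almost automorphic and asymptotically almost automorphic functions -/

/-- Bounded continuous `f : ℝ → X` is almost automorphic if every real sequence has a subsequence
`s ∘ σ` with `f (t + s (σ n)) → g t` and `g (t - s (σ n)) → f t` for each `t`. -/
def IsAA {X : Type*} [NormedAddCommGroup X] (f : ℝ → X) : Prop :=
  Continuous f ∧ (∃ c, ∀ t, ‖f t‖ ≤ c) ∧
    ∀ s : ℕ → ℝ, ∃ σ : ℕ → ℕ, StrictMono σ ∧ ∃ g : ℝ → X,
      (∀ t, Tendsto (fun n => f (t + s (σ n))) atTop (𝓝 (g t))) ∧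
      (∀ t, Tendsto (fun n => g (t - s (σ n))) atTop (𝓝 (f t)))

/-- Bounded continuous functions on `ℝ` that tend to `0` at `+∞`. -/
def IsCZero {X : Type*} [NormedAddCommGroup X] (h : ℝ → X) : Prop :=
  Continuous h ∧ (∃ c, ∀ t, ‖h t‖ ≤ c) ∧ Tendsto h atTop (𝓝 0)

/-- Asymptotically almost automorphic functions `ℝ → X`. -/
def IsAAA {X : Type*} [NormedAddCommGroup X] (f : ℝ → X) : Prop :=
  ∃ f₁ f₂ : ℝ → X, IsAA f₁ ∧ IsCZero f₂ ∧ ∀ t, f t = f₁ t + f₂ t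

/-- Jointly continuous and bounded on `ℝ × B` for every bounded set `B` of parameters. Every
bounded continuous function has this property. -/
def IsContBdd {Y X : Type*} [NormedAddCommGroup Y] [NormedAddCommGroup X] (f : ℝ → Y → X) : Prop :=
  Continuous (fun p : ℝ × Y => f p.1 p.2) ∧
    ∀ B : Set Y, Bornology.IsBounded B → ∃ c, ∀ t, ∀ y ∈ B, ‖f t y‖ ≤ c

/-- Almost automorphic in `t`, uniformly for the parameter in compact sets: the subsequence depends
only on the compact set and on the given sequence. -/
def IsAAParam {Y X : Type*} [NormedAddCommGroup Y] [NormedAddCommGroup X] (f : ℝ → Y → X) : Prop :=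
  IsContBdd f ∧
    ∀ K : Set Y, IsCompact K → ∀ s : ℕ → ℝ, ∃ σ : ℕ → ℕ, StrictMono σ ∧ ∃ g : ℝ → Y → X,
      (∀ t, ∀ y ∈ K, Tendsto (fun n => f (t + s (σ n)) y) atTop (𝓝 (g t y))) ∧
      (∀ t, ∀ y ∈ K, Tendsto (fun n => g (t - s (σ n)) y) atTop (𝓝 (f t y)))

/-- Functions of `(t, y)` that tend to `0` as `t → +∞`, uniformly for `y` in bounded sets. -/
def IsCZeroParam {Y X : Type*} [NormedAddCommGroup Y] [NormedAddCommGroup X]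
    (h : ℝ → Y → X) : Prop :=
  IsContBdd h ∧
    ∀ B : Set Y, Bornology.IsBounded B → TendstoUniformlyOn h (fun _ => 0) atTop B

/-- Asymptotically almost automorphic functions `ℝ × Y → X`. -/
def IsAAAParam {Y X : Type*} [NormedAddCommGroup Y] [NormedAddCommGroup X]
    (f : ℝ → Y → X) : Prop :=
  ∃ f₁ f₂ : ℝ → Y → X, IsAAParam f₁ ∧ IsCZeroParam f₂ ∧ ∀ t y, f t y = f₁ t y + f₂ t y

/-! ### Sectorial operators and the solution operator -/

section Operators

variable {X : Type*} [NormedAddCommGroup X] [NormedSpace ℂ X]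

/-- The bounded operator `R` is a two-sided inverse of `z - A : D(A) → X`. -/
def IsResolventAt (A : X →ₗ.[ℂ] X) (z : ℂ) (R : X →L[ℂ] X) : Prop :=
  (∀ x : X, ∃ y : A.domain, (y : X) = R x ∧ z • (y : X) - A y = x) ∧
    ∀ y : A.domain, R (z • (y : X) - A y) = y

open Classical in
/-- `(z - A)⁻¹`; the value is `0` if `z` is not in the resolvent set. -/
def resolventOp (A : X →ₗ.[ℂ] X) (z : ℂ) : X →L[ℂ] X :=
  if h : ∃ R, IsResolventAt A z R then h.choose else 0

/-- The sector `ω + S_θ = {ω + z : |arg (-z)| < θ}`. -/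
def shiftedSector (ω θ : ℝ) : Set ℂ := {z | |Complex.arg (-(z - (ω : ℂ)))| < θ}

/-- `A` is sectorial of type `ω` and angle `θ` with constant `M`. (The vertex `z = ω`, where the
right-hand side of the estimate is infinite, belongs to the sector here, since `arg 0 = 0 < θ`.) -/
structure IsSectorial (A : X →ₗ.[ℂ] X) (ω θ M : ℝ) : Prop where
  closed : A.IsClosed
  angle_pos : 0 < θ
  angle_lt : θ < Real.pi / 2
  const_pos : 0 < M
  resolvent_bound : ∀ z : ℂ, z ∉ shiftedSector ω θ →
    ∃ R : X →L[ℂ] X, IsResolventAt A z R ∧ ‖R‖ ≤ M / ‖z - (ω : ℂ)‖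

/-- The integrand `e^{zt} z^{α-1} (z^α - A)⁻¹`. -/
def solutionKernel (A : X →ₗ.[ℂ] X) (α t : ℝ) (z : ℂ) : X →L[ℂ] X :=
  (Complex.exp (z * (t : ℂ)) * z ^ ((α : ℂ) - 1)) • resolventOp A (z ^ (α : ℂ))

/-- The integral of `F` along the path that runs from `∞ e^{-iφ}` straight to `0` and then straight
to `∞ e^{iφ}`. -/
def wedgeIntegral (φ : ℝ) (F : ℂ → X →L[ℂ] X) : X →L[ℂ] X :=
  (∫ r in Ioi (0 : ℝ), Complex.exp (φ * Complex.I) • F (r * Complex.exp (φ * Complex.I)))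
    - ∫ r in Ioi (0 : ℝ), Complex.exp (-(φ * Complex.I)) • F (r * Complex.exp (-(φ * Complex.I)))

/-- The solution operator `S_α(t) = (2πi)⁻¹ ∫_γ e^{zt} z^{α-1} (z^α - A)⁻¹ dz` for `t > 0`, with `γ`
the path above, and `S_α(0) = I` (the contour integral does not converge absolutely at `t = 0`). -/
def solutionOp (A : X →ₗ.[ℂ] X) (α φ t : ℝ) : X →L[ℂ] X :=
  if t = 0 then ContinuousLinearMap.id ℂ X
  else (2 * (Real.pi : ℂ) * Complex.I)⁻¹ • wedgeIntegral φ (solutionKernel A α t)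

/-- `Ku(t) = ∫_{-∞}^t k(t-s) u(s) ds`. -/
def memoryOp (k : ℝ → ℂ) (u : ℝ → X) (t : ℝ) : X :=
  ∫ s in Iio t, k (t - s) • u s

/-- Mild solutions on `ℝ`: all the integrals converge absolutely and
`u(t) = ∫_{-∞}^t S(t-s) f(s, u(s), Ku(s)) ds` for every `t`. -/
def IsMildSolution (S : ℝ → X →L[ℂ] X) (k : ℝ → ℂ) (f : ℝ → X × X → X) (u : ℝ → X) : Prop :=
  (∀ t, IntegrableOn (fun s => k (t - s) • u s) (Iio t)) ∧
  (∀ t, IntegrableOn (fun s => S (t - s) (f s (u s, memoryOp k u s))) (Iio t)) ∧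
  ∀ t, u t = ∫ s in Iio t, S (t - s) (f s (u s, memoryOp k u s))

end Operators

end

/-! After the substitution `s ↦ t - s`, mild solutions are the fixed points of `u ↦ ∫_0^∞ S_α(s) F(t
- s) ds` with `F(s) = f(s, u(s), Ku(s))`, and Banach's theorem applies in the asymptotically almost
automorphic functions with the sup norm. This space is complete: an almost automorphic part is a
limit of limits of translates, which do not see the vanishing part, so its norm is at most that of
the sum (`IsAA.norm_le_of_add_tendsto`) and both parts converge (`isClosed_setOf_isAAA`). It is
invariant: superposition with a Lipschitz `f` preserves it (`IsAAAParam.comp`), and so does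
convolution with an integrable kernel, by dominated convergence
(`IsIntegrableKernel.isAAA_kernelConv`). The contraction constant is `L (1 + ‖k‖₁)` times the
integral of `CM / (1 + |ω| t^α)`, which a Gamma function computation evaluates; the product is `Λ`.
Some `C` exists because the contour integral decays like `t^(-α)`, while strong continuity gives a
uniform bound on `[0, 1]`. -/

/-! ### Diagonal subsequences -/

/-- Diagonal extraction: countably many properties of subsequences, each inherited by anything that
is eventually a subsequence and each attainable along any subsequence, hold along a common one. -/
theorem exists_strictMono_forall_of_hereditary (Q : ℕ → (ℕ → ℕ) → Prop)
    (hered : ∀ (n : ℕ) (σ τ ρ : ℕ → ℕ), Q n σ → Tendsto τ atTop atTop → ρ =ᶠ[atTop] σ ∘ τ → Q n ρ)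
    (extract : ∀ (n : ℕ) (σ : ℕ → ℕ), StrictMono σ → ∃ τ : ℕ → ℕ, StrictMono τ ∧ Q n (σ ∘ τ)) :
    ∃ δ : ℕ → ℕ, StrictMono δ ∧ ∀ n, Q n δ := by
  choose τ hτ hQ using extract
  let T : ℕ → {σ : ℕ → ℕ // StrictMono σ} := fun n =>
    Nat.rec ⟨id, strictMono_id⟩ (fun n σ => ⟨σ.1 ∘ τ n σ.1 σ.2, σ.2.comp (hτ n σ.1 σ.2)⟩) n
  have hT : ∀ n, (T (n + 1)).1 = (T n).1 ∘ τ n (T n).1 (T n).2 := fun n => rfl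
  have hfac : ∀ n j, ∃ ρ : ℕ → ℕ, StrictMono ρ ∧ (T (n + j)).1 = (T n).1 ∘ ρ := by
    intro n j
    induction j with
    | zero => exact ⟨id, strictMono_id, rfl⟩
    | succ j ih =>
      obtain ⟨ρ, hρ, h⟩ := ih
      refine ⟨ρ ∘ τ (n + j) (T (n + j)).1 (T (n + j)).2, hρ.comp (hτ _ _ _), ?_⟩
      exact (hT (n + j)).trans (congrArg (· ∘ τ (n + j) (T (n + j)).1 (T (n + j)).2) h)
  refine ⟨fun n => (T n).1 n, strictMono_nat_of_lt_succ fun n => ?_, fun n => ?_⟩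
  · rw [hT]
    exact (T n).2 (lt_of_lt_of_le n.lt_succ_self ((hτ n _ (T n).2).le_apply))
  · choose ρ hρ hρT using hfac (n + 1)
    -- Property `n` is first secured by `T (n + 1)`, and the diagonal is a subsequence of it only
    -- from index `n + 1` on; for smaller `m` the truncated subtraction gives a harmless value.
    refine hered n (T (n + 1)).1 (fun m => ρ (m - (n + 1)) m) _ (hQ n _ (T n).2) ?_ ?_
    · exact tendsto_atTop_mono (fun m => (hρ _).le_apply) tendsto_id
    · filter_upwards [eventually_ge_atTop (n + 1)] with m hm
      have := congrFun (hρT (m - (n + 1))) m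
      rwa [Nat.add_sub_cancel' hm] at this

/-! ### Almost automorphic functions -/

section AA

variable {X Y : Type*} [NormedAddCommGroup X] [NormedAddCommGroup Y]

theorem IsAA.prodMk {f : ℝ → X} {g : ℝ → Y} (hf : IsAA f) (hg : IsAA g) :
    IsAA (fun t => (f t, g t)) := by
  obtain ⟨hfc, ⟨a, ha⟩, hf⟩ := hf
  obtain ⟨hgc, ⟨b, hb⟩, hg⟩ := hg
  refine ⟨hfc.prodMk hgc, ⟨max a b, fun t => max_le_max (ha t) (hb t)⟩, fun s => ?_⟩
  obtain ⟨σ, hσ, F, hF, hF'⟩ := hf s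
  obtain ⟨τ, hτ, G, hG, hG'⟩ := hg (s ∘ σ)
  refine ⟨σ ∘ τ, hσ.comp hτ, fun t => (F t, G t), fun t => ?_, fun t => ?_⟩
  · exact ((hF t).comp hτ.tendsto_atTop).prodMk_nhds (hG t)
  · exact ((hF' t).comp hτ.tendsto_atTop).prodMk_nhds (hG' t)

theorem IsAA.sub {f g : ℝ → X} (hf : IsAA f) (hg : IsAA g) : IsAA (fun t => f t - g t) := by
  obtain ⟨hc, ⟨a, ha⟩, h⟩ := hf.prodMk hg
  refine ⟨hc.fst.sub hc.snd, ⟨a + a, fun t => (norm_sub_le _ _).trans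
    (add_le_add ((norm_fst_le _).trans (ha t)) ((norm_snd_le _).trans (ha t)))⟩, fun s => ?_⟩
  obtain ⟨σ, hσ, F, hF, hF'⟩ := h s
  refine ⟨σ, hσ, fun t => (F t).1 - (F t).2, fun t => ?_, fun t => ?_⟩
  · exact (hF t).fst_nhds.sub (hF t).snd_nhds
  · exact (hF' t).fst_nhds.sub (hF' t).snd_nhds

/-- The range of an almost automorphic function is relatively compact. -/
theorem IsAA.isCompact_closure_range {f : ℝ → X} (hf : IsAA f) :
    IsCompact (closure (range f)) := by
  refine IsSeqCompact.isCompact fun x hx => ?_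
  have happrox : ∀ n : ℕ, ∃ t, dist (x n) (f t) < 1 / ((n : ℝ) + 1) := fun n => by
    obtain ⟨_, ⟨t, rfl⟩, ht⟩ := Metric.mem_closure_iff.1 (hx n) _ Nat.one_div_pos_of_nat
    exact ⟨t, ht⟩
  choose s hs using happrox
  obtain ⟨σ, hσ, g, hg, -⟩ := hf.2.2 s
  -- Almost automorphy at `t = 0`, along the sequence `s` itself, is exactly convergence of a
  -- subsequence of the values `f (s n)`.
  have hg0 : Tendsto (fun n => f (s (σ n))) atTop (𝓝 (g 0)) := by simpa using hg 0
  refine ⟨g 0, mem_closure_of_tendsto hg0 (Eventually.of_forall fun n => mem_range_self _), σ, hσ,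
    (tendsto_iff_of_dist ?_).2 hg0⟩
  exact squeeze_zero (fun _ => dist_nonneg) (fun n => (hs (σ n)).le)
    (tendsto_one_div_add_atTop_nhds_zero_nat.comp hσ.tendsto_atTop)

/-- An almost automorphic function is bounded by any bound for a function asymptotic to it. -/
theorem IsAA.norm_le_of_add_tendsto {f h : ℝ → X} (hf : IsAA f) (hh : Tendsto h atTop (𝓝 0))
    {c : ℝ} (hc : ∀ t, ‖f t + h t‖ ≤ c) (t : ℝ) : ‖f t‖ ≤ c := by
  -- Translating towards `+∞` kills `h`, so the limit `g` is bounded by `c`; translating back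
  -- recovers `f` with the same bound.
  obtain ⟨σ, hσ, g, hg, hg'⟩ := hf.2.2 (fun n => (n : ℝ))
  have hgc : ∀ t, ‖g t‖ ≤ c := fun t => by
    have h1 : Tendsto (fun n => t + (σ n : ℝ)) atTop atTop :=
      tendsto_atTop_add_const_left _ _
        (tendsto_natCast_atTop_atTop.comp hσ.tendsto_atTop)
    have h2 := (hg t).add (hh.comp h1)
    rw [add_zero] at h2
    exact le_of_tendsto h2.norm (Eventually.of_forall fun n => hc _)
  exact le_of_tendsto (hg' t).norm (Eventually.of_forall fun n => hgc _)

/-- A diagonal subsequence serves every `f n` at once. Limits of translates do not increase sup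
distances, so the limit functions `g n` are uniformly Cauchy, and uniformity permits exchanging the
limits in both directions of translation. -/
theorem IsAA.of_tendstoUniformly [CompleteSpace X] {f : ℕ → ℝ → X} {F : ℝ → X}
    (hf : ∀ n, IsAA (f n)) (hF : TendstoUniformly f F atTop) : IsAA F := by
  have hFc : Continuous F := hF.continuous (Frequently.of_forall fun n => (hf n).1)
  refine ⟨hFc, ?_, fun s => ?_⟩
  · obtain ⟨n, hn⟩ := ((Metric.tendstoUniformly_iff.1 hF) 1 one_pos).exists
    obtain ⟨c, hc⟩ := (hf n).2.1
    refine ⟨1 + c, fun t => ?_⟩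
    calc ‖F t‖ = ‖(F t - f n t) + f n t‖ := by simp
      _ ≤ _ := (norm_add_le _ _).trans
        (add_le_add (by simpa [dist_eq_norm] using (hn t).le) (hc t))
  · obtain ⟨σ, hσ, h⟩ := exists_strictMono_forall_of_hereditary
      (fun n σ => ∃ g : ℝ → X,
        (∀ t, Tendsto (fun j => f n (t + s (σ j))) atTop (𝓝 (g t))) ∧
        (∀ t, Tendsto (fun j => g (t - s (σ j))) atTop (𝓝 (f n t))))
      (fun n σ τ ρ ⟨g, hg, hg'⟩ hτ hρ =>
        ⟨g, fun t => ((hg t).comp hτ).congr' (hρ.mono fun j hj => by simp [hj]),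
          fun t => ((hg' t).comp hτ).congr' (hρ.mono fun j hj => by simp [hj])⟩)
      (fun n σ _ => (hf n).2.2 (s ∘ σ))
    choose g hg hg' using h
    have hcau : ∀ ε > 0, ∃ N, ∀ m ≥ N, ∀ n ≥ N, ∀ t, dist (g m t) (g n t) ≤ ε := by
      intro ε hε
      obtain ⟨N, hN⟩ := Metric.uniformCauchySeqOn_iff.1
        ((tendstoUniformlyOn_univ.2 hF).uniformCauchySeqOn) ε hε
      exact ⟨N, fun m hm n hn t => le_of_tendsto ((hg m t).dist (hg n t))
        (Eventually.of_forall fun j => (hN m hm n hn _ (mem_univ _)).le)⟩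
    have hlim : ∀ t, ∃ x, Tendsto (fun n => g n t) atTop (𝓝 x) := fun t => by
      refine cauchySeq_tendsto_of_complete (Metric.cauchySeq_iff.2 fun ε hε => ?_)
      obtain ⟨N, hN⟩ := hcau (ε / 2) (half_pos hε)
      exact ⟨N, fun m hm n hn => (hN m hm n hn t).trans_lt (half_lt_self hε)⟩
    choose G hG using hlim
    have hGu : TendstoUniformly g G atTop := by
      refine Metric.tendstoUniformly_iff.2 fun ε hε => ?_
      obtain ⟨N, hN⟩ := hcau (ε / 2) (half_pos hε)
      filter_upwards [eventually_ge_atTop N] with n hn t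
      refine lt_of_le_of_lt (le_of_tendsto ((hG t).dist tendsto_const_nhds) ?_) (half_lt_self hε)
      filter_upwards [eventually_ge_atTop N] with m hm using hN m hm n hn t
    refine ⟨σ, hσ, G, fun t => ?_, fun t => ?_⟩
    · exact (hF.comp fun j => t + s (σ j)).tendsto_of_eventually_tendsto
        (Eventually.of_forall fun n => hg n t) (hG t)
    · exact (hGu.comp fun j => t - s (σ j)).tendsto_of_eventually_tendsto
        (Eventually.of_forall fun n => hg' n t) (hF.tendsto_at t)

theorem IsCZero.of_tendstoUniformly {f : ℕ → ℝ → X} {F : ℝ → X}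
    (hf : ∀ n, IsCZero (f n)) (hF : TendstoUniformly f F atTop) : IsCZero F := by
  refine ⟨hF.continuous (Frequently.of_forall fun n => (hf n).1), ?_, ?_⟩
  · obtain ⟨n, hn⟩ := ((Metric.tendstoUniformly_iff.1 hF) 1 one_pos).exists
    obtain ⟨c, hc⟩ := (hf n).2.1
    refine ⟨1 + c, fun t => ?_⟩
    calc ‖F t‖ = ‖(F t - f n t) + f n t‖ := by simp
      _ ≤ _ := (norm_add_le _ _).trans
        (add_le_add (by simpa [dist_eq_norm] using (hn t).le) (hc t))
  · exact hF.tendsto_of_eventually_tendsto (Eventually.of_forall fun n => (hf n).2.2)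
      tendsto_const_nhds

/-! ### Asymptotically almost automorphic functions -/

theorem IsAAA.continuous {f : ℝ → X} (hf : IsAAA f) : Continuous f := by
  obtain ⟨f₁, f₂, h₁, h₂, h⟩ := hf
  rw [funext h]
  exact h₁.1.add h₂.1

theorem IsAAA.exists_norm_le {f : ℝ → X} (hf : IsAAA f) : ∃ c, ∀ t, ‖f t‖ ≤ c := by
  obtain ⟨f₁, f₂, ⟨-, ⟨a, ha⟩, -⟩, ⟨-, ⟨b, hb⟩, -⟩, h⟩ := hf
  exact ⟨a + b, fun t => by rw [h]; exact (norm_add_le _ _).trans (add_le_add (ha t) (hb t))⟩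

theorem isAAA_zero : IsAAA (fun _ : ℝ => (0 : X)) :=
  ⟨fun _ => 0, fun _ => 0,
    ⟨continuous_const, ⟨0, fun _ => by simp⟩, fun _ => ⟨id, strictMono_id, fun _ => 0,
      fun _ => tendsto_const_nhds, fun _ => tendsto_const_nhds⟩⟩,
    ⟨continuous_const, ⟨0, fun _ => by simp⟩, tendsto_const_nhds⟩, fun _ => by simp⟩

theorem IsAAA.prodMk {f : ℝ → X} {g : ℝ → Y} (hf : IsAAA f) (hg : IsAAA g) :
    IsAAA (fun t => (f t, g t)) := by
  obtain ⟨f₁, f₂, hf₁, ⟨hfc, ⟨a, ha⟩, hf₂⟩, hf⟩ := hf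
  obtain ⟨g₁, g₂, hg₁, ⟨hgc, ⟨b, hb⟩, hg₂⟩, hg⟩ := hg
  exact ⟨_, fun t => (f₂ t, g₂ t), hf₁.prodMk hg₁, ⟨hfc.prodMk hgc,
    ⟨max a b, fun t => max_le_max (ha t) (hb t)⟩, hf₂.prodMk_nhds hg₂⟩,
    fun t => by simp [hf, hg]⟩

open BoundedContinuousFunction in
/-- The asymptotically almost automorphic functions form a closed subset of the bounded continuous
functions. -/
theorem isClosed_setOf_isAAA [CompleteSpace X] :
    IsClosed {u : ℝ →ᵇ X | IsAAA u} := by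
  refine IsSeqClosed.isClosed fun u v hu huv => ?_
  choose f₁ f₂ h₁ h₂ h using hu
  choose c hc using fun n => (h₁ n).2.1
  let F : ℕ → ℝ →ᵇ X := fun n => ofNormedAddCommGroup (f₁ n) (h₁ n).1 (c n) (hc n)
  -- The almost automorphic parts are no further apart than the sums, so they form a Cauchy
  -- sequence; the vanishing parts then converge as differences.
  have hFu : ∀ m n, dist (F m) (F n) ≤ dist (u m) (u n) := fun m n => by
    refine (dist_le dist_nonneg).2 fun t => ?_
    rw [dist_eq_norm]
    refine ((h₁ m).sub (h₁ n)).norm_le_of_add_tendsto (h := fun t => f₂ m t - f₂ n t)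
      (by simpa using (h₂ m).2.2.sub (h₂ n).2.2) (fun t => ?_) t
    refine le_trans (le_of_eq ?_) (dist_coe_le_dist (f := u m) (g := u n) t)
    rw [dist_eq_norm, h m, h n]
    congr 1
    abel
  have hFc : CauchySeq F := by
    refine Metric.cauchySeq_iff.2 fun ε hε => ?_
    obtain ⟨N, hN⟩ := Metric.cauchySeq_iff.1 huv.cauchySeq ε hε
    exact ⟨N, fun m hm n hn => (hFu m n).trans_lt (hN m hm n hn)⟩
  obtain ⟨G, hG⟩ := cauchySeq_tendsto_of_complete hFc
  refine ⟨G, fun t => v t - G t, IsAA.of_tendstoUniformly (f := f₁) h₁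
    (tendsto_iff_tendstoUniformly.1 hG), IsCZero.of_tendstoUniformly (f := f₂) h₂ ?_,
    fun t => by simp⟩
  have := tendsto_iff_tendstoUniformly.1 (huv.sub hG)
  have heq : f₂ = fun n => ⇑(u n - F n) := by
    funext n t
    simp [F, h n]
  rwa [heq]

/-! ### Superposition -/

/-- The almost automorphic part inherits Lipschitz bounds. -/
theorem IsAAParam.norm_sub_le_of_add {f₁ f₂ : ℝ → Y → X} (h₁ : IsAAParam f₁)
    (h₂ : IsCZeroParam f₂) {y z : Y} {c : ℝ}
    (hc : ∀ t, ‖(f₁ t y + f₂ t y) - (f₁ t z + f₂ t z)‖ ≤ c) (t : ℝ) :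
    ‖f₁ t y - f₁ t z‖ ≤ c := by
  have haa : ∀ y, IsAA (fun t => f₁ t y) := fun y => by
    refine ⟨h₁.1.1.comp (by fun_prop : Continuous fun t : ℝ => (t, y)), ?_, fun s => ?_⟩
    · obtain ⟨c, hc⟩ := h₁.1.2 {y} Bornology.isBounded_singleton
      exact ⟨c, fun t => hc t y rfl⟩
    · obtain ⟨σ, hσ, g, hg, hg'⟩ := h₁.2 {y} isCompact_singleton s
      exact ⟨σ, hσ, fun t => g t y, fun t => hg t y rfl, fun t => hg' t y rfl⟩
  have h0 : ∀ y, Tendsto (fun t => f₂ t y) atTop (𝓝 0) := fun y =>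
    (h₂.2 {y} Bornology.isBounded_singleton).tendsto_at rfl
  refine ((haa y).sub (haa z)).norm_le_of_add_tendsto (h := fun t => f₂ t y - f₂ t z)
    (by simpa using (h0 y).sub (h0 z)) (fun t => ?_) t
  convert hc t using 2
  abel

/-- The range of `y` has compact closure, so one subsequence works for `y` and for `f` with
parameters in that closure. The Lipschitz bound passes to the limit `g` there and absorbs the motion
of the argument. -/
theorem IsAAParam.comp {f : ℝ → Y → X} (hf : IsAAParam f) {L : ℝ}
    (hL : ∀ t y z, ‖f t y - f t z‖ ≤ L * ‖y - z‖) {y : ℝ → Y} (hy : IsAA y) :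
    IsAA (fun t => f t (y t)) := by
  refine ⟨hf.1.1.comp (continuous_id.prodMk hy.1), ?_, fun s => ?_⟩
  · obtain ⟨c, hc⟩ := hf.1.2 _ hy.isCompact_closure_range.isBounded
    exact ⟨c, fun t => hc t _ (subset_closure (mem_range_self t))⟩
  · obtain ⟨σ, hσ, h, hh, hh'⟩ := hy.2.2 s
    obtain ⟨τ, hτ, g, hg, hg'⟩ := hf.2 _ hy.isCompact_closure_range (s ∘ σ)
    -- Nothing is known about `g t` off this compact set, so `h` must be shown to stay in it.
    have hmem : ∀ t, h t ∈ closure (range y) := fun t =>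
      mem_closure_of_tendsto (hh t) (Eventually.of_forall fun n => mem_range_self _)
    have hymem : ∀ t, y t ∈ closure (range y) := fun t => subset_closure (mem_range_self t)
    have hgL : ∀ t, ∀ a ∈ closure (range y), ∀ b ∈ closure (range y),
        ‖g t a - g t b‖ ≤ L * ‖a - b‖ := fun t a ha b hb =>
      le_of_tendsto ((hg t a ha).sub (hg t b hb)).norm (Eventually.of_forall fun n => hL _ _ _)
    have key : ∀ (F : ℕ → Y → X) (w : ℕ → Y) (a : Y) (x : X),
        (∀ n, ‖F n (w n) - F n a‖ ≤ L * ‖w n - a‖) → Tendsto w atTop (𝓝 a) →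
        Tendsto (fun n => F n a) atTop (𝓝 x) → Tendsto (fun n => F n (w n)) atTop (𝓝 x) := by
      intro F w a x hF hw hx
      have h1 : Tendsto (fun n => L * ‖w n - a‖) atTop (𝓝 0) := by
        simpa using (tendsto_iff_norm_sub_tendsto_zero.1 hw).const_mul L
      simpa using (squeeze_zero_norm hF h1).add hx
    refine ⟨σ ∘ τ, hσ.comp hτ, fun t => g t (h t), fun t => ?_, fun t => ?_⟩
    · exact key (fun n => f (t + s (σ (τ n)))) _ (h t) _ (fun n => hL _ _ _)
        ((hh t).comp hτ.tendsto_atTop) (hg t _ (hmem t))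
    · exact key (fun n => g (t - s (σ (τ n)))) _ (y t) _
        (fun n => hgL _ _ (hmem _) _ (hymem t))
        ((hh' t).comp hτ.tendsto_atTop) (hg' t _ (hymem t))

/-- Split `f(t, y)` as `f₁(t, y₁) + [f₁(t, y) - f₁(t, y₁)] + f₂(t, y)`. The bracket is at most `L
‖y₂‖`, and the last term vanishes at `+∞` because `y` is bounded. -/
theorem IsAAAParam.comp {f : ℝ → Y → X} (hf : IsAAAParam f) {L : ℝ}
    (hL : ∀ t y z, ‖f t y - f t z‖ ≤ L * ‖y - z‖) {y : ℝ → Y} (hy : IsAAA y) :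
    IsAAA (fun t => f t (y t)) := by
  obtain ⟨f₁, f₂, h₁, h₂, hf⟩ := hf
  have hyc := hy.continuous
  obtain ⟨c, hc⟩ := hy.exists_norm_le
  obtain ⟨y₁, y₂, hy₁, hy₂, hy⟩ := hy
  have hL₁ : ∀ t y z, ‖f₁ t y - f₁ t z‖ ≤ L * ‖y - z‖ := fun t y z =>
    h₁.norm_sub_le_of_add h₂ (fun t => by simpa only [hf] using hL t y z) t
  have hyB : ∀ t, y t ∈ Metric.closedBall (0 : Y) c := fun t => by simpa using hc t
  have hA := h₁.comp hL₁ hy₁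
  obtain ⟨a, ha⟩ := hA.2.1
  obtain ⟨b₁, hb₁⟩ := h₁.1.2 _ (Metric.isBounded_closedBall (x := (0 : Y)) (r := c))
  obtain ⟨b₂, hb₂⟩ := h₂.1.2 _ (Metric.isBounded_closedBall (x := (0 : Y)) (r := c))
  refine ⟨_, fun t => (f₁ t (y t) - f₁ t (y₁ t)) + f₂ t (y t), hA, ⟨?_, ?_, ?_⟩,
    fun t => by simp only [hf]; abel⟩
  · exact ((h₁.1.1.comp (continuous_id.prodMk hyc)).sub hA.1).add
      (h₂.1.1.comp (continuous_id.prodMk hyc))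
  · exact ⟨b₁ + a + b₂, fun t => (norm_add_le _ _).trans (add_le_add
      ((norm_sub_le _ _).trans (add_le_add (hb₁ t _ (hyB t)) (ha t))) (hb₂ t _ (hyB t)))⟩
  · have h1 : Tendsto (fun t => f₁ t (y t) - f₁ t (y₁ t)) atTop (𝓝 0) := by
      refine squeeze_zero_norm (a := fun t => L * ‖y₂ t‖) (fun t => ?_)
        (by simpa using hy₂.2.2.norm.const_mul L)
      simpa [hy t] using hL₁ t (y t) (y₁ t)
    have h2 : Tendsto (fun t => f₂ t (y t)) atTop (𝓝 0) := by
      refine Metric.tendsto_nhds.2 fun ε hε => ?_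
      filter_upwards [Metric.tendstoUniformlyOn_iff.1 (h₂.2 _ Metric.isBounded_closedBall) ε hε]
        with t ht
      rw [dist_comm]
      exact ht _ (hyB t)
    simpa using h1.add h2

end AA

/-! ### Convolution with an integrable operator family -/

section Convolution

variable {X : Type*} [NormedAddCommGroup X] [NormedSpace ℂ X]

/-- An operator family on `(0, ∞)` with an integrable norm bound `b`, such that `s ↦ T s (u s)` is
measurable for continuous `u`. -/
structure IsIntegrableKernel (T : ℝ → X →L[ℂ] X) (b : ℝ → ℝ) : Prop where
  meas : ∀ u : ℝ → X, Continuous u →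
    AEStronglyMeasurable (fun s => T s (u s)) (volume.restrict (Ioi 0))
  norm_le : ∀ s, 0 < s → ‖T s‖ ≤ b s
  integrable : IntegrableOn b (Ioi 0)

/-- `∫_0^∞ T(s) u(t - s) ds`. -/
noncomputable def kernelConv (T : ℝ → X →L[ℂ] X) (u : ℝ → X) (t : ℝ) : X :=
  ∫ s in Ioi (0 : ℝ), T s (u (t - s))

variable {T : ℝ → X →L[ℂ] X} {b : ℝ → ℝ}

/-- The reflection moves `t` out of the domain and the kernel into the argument of `u`, so that
dominated convergence applies on a fixed domain. -/
theorem setIntegral_Iio_eq_kernelConv (T : ℝ → X →L[ℂ] X) (u : ℝ → X) (t : ℝ) :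
    ∫ s in Iio t, T (t - s) (u s) = kernelConv T u t := by
  have h := (Measure.measurePreserving_sub_left volume t).setIntegral_preimage_emb
    (MeasurableEquiv.subLeft t).measurableEmbedding (fun s => T s (u (t - s))) (Ioi 0)
  have hpre : (fun s : ℝ => t - s) ⁻¹' Ioi 0 = Iio t := by ext; simp
  rw [hpre] at h
  simpa [kernelConv] using h

theorem integrableOn_Iio_iff (T : ℝ → X →L[ℂ] X) (u : ℝ → X) (t : ℝ) :
    IntegrableOn (fun s => T (t - s) (u s)) (Iio t) ↔
      IntegrableOn (fun s => T s (u (t - s))) (Ioi 0) := by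
  have h := (Measure.measurePreserving_sub_left volume t).integrableOn_comp_preimage
    (MeasurableEquiv.subLeft t).measurableEmbedding (f := fun s => T s (u (t - s))) (s := Ioi 0)
  have hpre : (fun s : ℝ => t - s) ⁻¹' Ioi 0 = Iio t := by ext; simp
  rw [hpre] at h
  simpa [Function.comp_def] using h

theorem IsIntegrableKernel.norm_apply_le (hT : IsIntegrableKernel T b) {c s : ℝ} (hs : 0 < s)
    {x : X} (hx : ‖x‖ ≤ c) : ‖T s x‖ ≤ b s * c :=
  (T s).le_of_opNorm_le_of_le (hT.norm_le s hs) hx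

theorem IsIntegrableKernel.integrableOn (hT : IsIntegrableKernel T b) {u : ℝ → X}
    (hu : Continuous u) {c : ℝ} (hc : ∀ t, ‖u t‖ ≤ c) (t : ℝ) :
    IntegrableOn (fun s => T s (u (t - s))) (Ioi 0) := by
  refine Integrable.mono' (hT.integrable.mul_const c)
    (hT.meas (fun s => u (t - s)) (by fun_prop)) ?_
  exact (ae_restrict_iff' measurableSet_Ioi).2
    (Eventually.of_forall fun s hs => hT.norm_apply_le hs (hc _))

theorem IsIntegrableKernel.norm_kernelConv_le (hT : IsIntegrableKernel T b) {u : ℝ → X}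
    {c : ℝ} (hc : ∀ t, ‖u t‖ ≤ c) (t : ℝ) :
    ‖kernelConv T u t‖ ≤ (∫ s in Ioi (0 : ℝ), b s) * c := by
  rw [← integral_mul_const]
  refine norm_integral_le_of_norm_le (hT.integrable.mul_const c) ?_
  exact (ae_restrict_iff' measurableSet_Ioi).2
    (Eventually.of_forall fun s hs => hT.norm_apply_le hs (hc _))

/-- Dominated convergence for `kernelConv`. -/
theorem IsIntegrableKernel.tendsto_kernelConv (hT : IsIntegrableKernel T b) {ι : Type*}
    {l : Filter ι} [l.IsCountablyGenerated] {v : ι → ℝ → X} {w : ℝ → X} {c : ℝ}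
    (hv : ∀ i, AEStronglyMeasurable (fun s => T s (v i s)) (volume.restrict (Ioi 0)))
    (hc : ∀ i s, ‖v i s‖ ≤ c) (hlim : ∀ s, Tendsto (fun i => v i s) l (𝓝 (w s))) :
    Tendsto (fun i => ∫ s in Ioi (0 : ℝ), T s (v i s)) l (𝓝 (∫ s in Ioi (0 : ℝ), T s (w s))) := by
  refine tendsto_integral_filter_of_dominated_convergence (fun s => b s * c)
    (Eventually.of_forall hv) (Eventually.of_forall fun i => ?_) (hT.integrable.mul_const c)
    (Eventually.of_forall fun s => ((T s).continuous.tendsto _).comp (hlim s))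
  exact (ae_restrict_iff' measurableSet_Ioi).2
    (Eventually.of_forall fun s hs => hT.norm_apply_le hs (hc _ _))

theorem IsIntegrableKernel.continuous_kernelConv (hT : IsIntegrableKernel T b) {u : ℝ → X}
    (hu : Continuous u) {c : ℝ} (hc : ∀ t, ‖u t‖ ≤ c) : Continuous (kernelConv T u) :=
  continuous_iff_continuousAt.2 fun t =>
    hT.tendsto_kernelConv (v := fun t s => u (t - s)) (w := fun s => u (t - s))
      (fun t => hT.meas (fun s => u (t - s)) (by fun_prop)) (fun _ _ => hc _)
      (fun s => (by fun_prop : Continuous fun t => u (t - s)).tendsto t)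

theorem IsIntegrableKernel.isAA_kernelConv (hT : IsIntegrableKernel T b) {u : ℝ → X}
    (hu : IsAA u) : IsAA (kernelConv T u) := by
  obtain ⟨huc, ⟨c, hc⟩, hu⟩ := hu
  refine ⟨hT.continuous_kernelConv huc hc, ⟨_, hT.norm_kernelConv_le hc⟩, fun s => ?_⟩
  obtain ⟨σ, hσ, g, hg, hg'⟩ := hu s
  have hgc : ∀ t, ‖g t‖ ≤ c := fun t =>
    le_of_tendsto (hg t).norm (Eventually.of_forall fun n => hc _)
  -- As a pointwise limit, `g` need not be continuous; measurability is inherited from the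
  -- translates of `u`.
  have hgm : ∀ t, AEStronglyMeasurable (fun r => T r (g (t - r))) (volume.restrict (Ioi 0)) :=
    fun t => aestronglyMeasurable_of_tendsto_ae atTop
      (fun n => hT.meas (fun r => u (t - r + s (σ n))) (by fun_prop))
      (Eventually.of_forall fun r => ((T r).continuous.tendsto _).comp (hg (t - r)))
  refine ⟨σ, hσ, kernelConv T g, fun t => ?_, fun t => ?_⟩
  · refine hT.tendsto_kernelConv (v := fun n r => u (t + s (σ n) - r))
      (fun n => hT.meas (fun r => u (t + s (σ n) - r)) (by fun_prop)) (fun _ _ => hc _)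
      fun r => ?_
    convert hg (t - r) using 3
    ring
  · refine hT.tendsto_kernelConv (v := fun n r => g (t - s (σ n) - r))
      (fun n => hgm _) (fun _ _ => hgc _) fun r => ?_
    convert hg' (t - r) using 3
    ring

theorem IsIntegrableKernel.isCZero_kernelConv (hT : IsIntegrableKernel T b) {u : ℝ → X}
    (hu : IsCZero u) : IsCZero (kernelConv T u) := by
  obtain ⟨huc, ⟨c, hc⟩, hu⟩ := hu
  refine ⟨hT.continuous_kernelConv huc hc, ⟨_, hT.norm_kernelConv_le hc⟩, ?_⟩
  have := hT.tendsto_kernelConv (v := fun t s => u (t - s)) (w := fun _ => 0) (l := atTop)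
      (fun t => hT.meas (fun s => u (t - s)) (by fun_prop)) (fun _ _ => hc _)
      (fun s => hu.comp (tendsto_atTop_add_const_right _ (-s) tendsto_id))
  simp only [map_zero, integral_zero] at this
  exact this

theorem IsIntegrableKernel.kernelConv_add (hT : IsIntegrableKernel T b) {u v : ℝ → X}
    (hu : Continuous u) (hv : Continuous v) {c d : ℝ} (hc : ∀ t, ‖u t‖ ≤ c)
    (hd : ∀ t, ‖v t‖ ≤ d) (t : ℝ) :
    kernelConv T (fun t => u t + v t) t = kernelConv T u t + kernelConv T v t := by
  simp only [kernelConv, map_add]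
  exact integral_add (hT.integrableOn hu hc t) (hT.integrableOn hv hd t)

theorem IsIntegrableKernel.norm_kernelConv_sub_le (hT : IsIntegrableKernel T b) {u v : ℝ → X}
    (hu : Continuous u) (hv : Continuous v) {c d e : ℝ} (hc : ∀ t, ‖u t‖ ≤ c)
    (hd : ∀ t, ‖v t‖ ≤ d) (he : ∀ t, ‖u t - v t‖ ≤ e) (t : ℝ) :
    ‖kernelConv T u t - kernelConv T v t‖ ≤ (∫ s in Ioi (0 : ℝ), b s) * e := by
  have h : kernelConv T u t - kernelConv T v t = kernelConv T (fun t => u t - v t) t := by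
    simp only [kernelConv, map_sub]
    exact (integral_sub (hT.integrableOn hu hc t) (hT.integrableOn hv hd t)).symm
  rw [h]
  exact hT.norm_kernelConv_le he t

theorem IsIntegrableKernel.isAAA_kernelConv (hT : IsIntegrableKernel T b) {u : ℝ → X}
    (hu : IsAAA u) : IsAAA (kernelConv T u) := by
  obtain ⟨u₁, u₂, h₁, h₂, h⟩ := hu
  refine ⟨_, _, hT.isAA_kernelConv h₁, hT.isCZero_kernelConv h₂, fun t => ?_⟩
  obtain ⟨c, hc⟩ := h₁.2.1
  obtain ⟨d, hd⟩ := h₂.2.1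
  rw [funext h]
  exact hT.kernelConv_add h₁.1 h₂.1 hc hd t

end Convolution

/-! ### The integral of `1 / (1 + w t ^ α)` -/

/-- Write `1/p = ∫_0^∞ e^(-px) dx` with `p = 1 + w t^α` and swap by Tonelli. The `t`-integral gives
`Γ(1/α + 1) (xw)^(-1/α)`, the `x`-integral `Γ(1 - 1/α)`, and the reflection formula finishes.
Working with lower integrals also yields integrability. -/
theorem lintegral_one_div_one_add_mul_rpow {α w : ℝ} (hα : 1 < α) (hw : 0 < w) :
    ∫⁻ t in Ioi (0 : ℝ), ENNReal.ofReal (1 / (1 + w * t ^ α)) =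
      ENNReal.ofReal (w ^ (-(1 / α)) * Real.pi / (α * Real.sin (Real.pi / α))) := by
  have hα0 : 0 < α := one_pos.trans hα
  have hα1 : 1 / α < 1 := (div_lt_one hα0).2 hα
  have hpos : 0 < 1 / α := by positivity
  have hleft : ∀ t ∈ Ioi (0 : ℝ), ENNReal.ofReal (1 / (1 + w * t ^ α)) =
      ∫⁻ x in Ioi (0 : ℝ), ENNReal.ofReal (Real.exp (-(1 + w * t ^ α) * x)) := by
    intro t ht
    have hp : 0 < 1 + w * t ^ α := by have := Real.rpow_pos_of_pos ht α; positivity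
    rw [← ofReal_integral_eq_lintegral_ofReal (integrableOn_exp_mul_Ioi (by linarith) 0)
      (Eventually.of_forall fun x => (Real.exp_pos _).le),
      integral_exp_mul_Ioi (by linarith)]
    rw [mul_zero, Real.exp_zero, neg_div_neg_eq]
  have hright : ∀ x ∈ Ioi (0 : ℝ),
      ∫⁻ t in Ioi (0 : ℝ), ENNReal.ofReal (Real.exp (-(1 + w * t ^ α) * x)) =
      ENNReal.ofReal (w ^ (-(1 / α)) * Real.Gamma (1 / α + 1) *
        (Real.exp (-x) * x ^ (1 - 1 / α - 1))) := by
    intro x hx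
    have hx' : (0 : ℝ) < x := hx
    have hval := integral_exp_neg_mul_rpow hα0 (mul_pos hx' hw)
    have hint : IntegrableOn (fun t : ℝ => Real.exp (-(x * w) * t ^ α)) (Ioi 0) := by
      -- A non-integrable function has Bochner integral `0` by convention, so a nonzero value proves
      -- integrability.
      refine Integrable.of_integral_ne_zero ?_
      rw [hval]
      exact (mul_pos (Real.rpow_pos_of_pos (mul_pos hx' hw) _)
        (Real.Gamma_pos_of_pos (by positivity))).ne'
    have hfac : ∀ t : ℝ, Real.exp (-(1 + w * t ^ α) * x) =
        Real.exp (-x) * Real.exp (-(x * w) * t ^ α) := fun t => by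
      rw [← Real.exp_add]; ring_nf
    simp_rw [hfac]
    rw [← ofReal_integral_eq_lintegral_ofReal (hint.const_mul _)
      (Eventually.of_forall fun t => by positivity), integral_const_mul, hval,
      Real.mul_rpow hx'.le hw.le]
    congr 1
    rw [show (1 - 1 / α - 1 : ℝ) = -1 / α by ring, show -(1 / α) = -1 / α by ring]
    ring
  rw [setLIntegral_congr_fun measurableSet_Ioi hleft, lintegral_lintegral_swap,
    setLIntegral_congr_fun measurableSet_Ioi hright]
  · have hG : 0 < 1 - 1 / α := by linarith
    have hC : 0 ≤ w ^ (-(1 / α)) * Real.Gamma (1 / α + 1) :=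
      mul_nonneg (Real.rpow_nonneg hw.le _) (Real.Gamma_pos_of_pos (by positivity)).le
    rw [← ofReal_integral_eq_lintegral_ofReal ((Real.GammaIntegral_convergent hG).const_mul _),
      integral_const_mul, ← Real.Gamma_eq_integral hG, Real.Gamma_add_one hpos.ne']
    · congr 1
      have := Real.Gamma_mul_Gamma_one_sub (1 / α)
      rw [show w ^ (-(1 / α)) * (1 / α * Real.Gamma (1 / α)) * Real.Gamma (1 - 1 / α) =
        w ^ (-(1 / α)) * (1 / α) * (Real.Gamma (1 / α) * Real.Gamma (1 - 1 / α)) by ring, this,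
        show Real.pi * (1 / α) = Real.pi / α by ring]
      rw [mul_one_div, div_mul_div_comm]
    · exact (ae_restrict_iff' measurableSet_Ioi).2 (Eventually.of_forall fun x hx =>
        mul_nonneg hC (mul_nonneg (Real.exp_pos _).le (Real.rpow_nonneg (le_of_lt hx) _)))
  · refine Measurable.aemeasurable ?_
    fun_prop

theorem sin_pi_div_pos {α : ℝ} (hα : 1 < α) : 0 < Real.sin (Real.pi / α) :=
  Real.sin_pos_of_pos_of_lt_pi (div_pos Real.pi_pos (one_pos.trans hα))
    (div_lt_self Real.pi_pos hα)

theorem integrableOn_one_div_one_add_mul_rpow {α w : ℝ} (hα : 1 < α) (hw : 0 < w) :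
    IntegrableOn (fun t : ℝ => 1 / (1 + w * t ^ α)) (Ioi 0) := by
  have hnn : ∀ᵐ t ∂volume.restrict (Ioi (0 : ℝ)), 0 ≤ 1 / (1 + w * t ^ α) :=
    (ae_restrict_iff' measurableSet_Ioi).2 (Eventually.of_forall fun t ht => by
      have := Real.rpow_nonneg (le_of_lt ht) α; positivity)
  refine ⟨Measurable.aestronglyMeasurable (by fun_prop), ?_⟩
  rw [hasFiniteIntegral_iff_ofReal hnn, lintegral_one_div_one_add_mul_rpow hα hw]
  exact ENNReal.ofReal_lt_top

theorem integral_one_div_one_add_mul_rpow {α w : ℝ} (hα : 1 < α) (hw : 0 < w) :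
    ∫ t in Ioi (0 : ℝ), 1 / (1 + w * t ^ α) =
      w ^ (-(1 / α)) * Real.pi / (α * Real.sin (Real.pi / α)) := by
  have hnn : ∀ᵐ t ∂volume.restrict (Ioi (0 : ℝ)), 0 ≤ 1 / (1 + w * t ^ α) :=
    (ae_restrict_iff' measurableSet_Ioi).2 (Eventually.of_forall fun t ht => by
      have := Real.rpow_nonneg (le_of_lt ht) α; positivity)
  rw [integral_eq_lintegral_of_nonneg_ae hnn (Measurable.aestronglyMeasurable (by fun_prop)),
    lintegral_one_div_one_add_mul_rpow hα hw, ENNReal.toReal_ofReal]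
  have := sin_pi_div_pos hα
  have := Real.pi_pos
  have := Real.rpow_nonneg hw.le (-(1 / α))
  have := one_pos.trans hα
  positivity

/-! ### Decay of the solution operator -/

section Operators

variable {X : Type*} [NormedAddCommGroup X] [NormedSpace ℂ X]

theorem IsResolventAt.unique {A : X →ₗ.[ℂ] X} {z : ℂ} {R R' : X →L[ℂ] X}
    (h : IsResolventAt A z R) (h' : IsResolventAt A z R') : R = R' := by
  ext x
  obtain ⟨y, hy, hyx⟩ := h.1 x
  rw [← hy, ← h'.2 y, hyx]

theorem IsSectorial.norm_resolventOp_le {A : X →ₗ.[ℂ] X} {ω θ M : ℝ} (hA : IsSectorial A ω θ M)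
    {z : ℂ} (hz : z ∉ shiftedSector ω θ) : ‖resolventOp A z‖ ≤ M / ‖z - (ω : ℂ)‖ := by
  obtain ⟨R, hR, hle⟩ := hA.resolvent_bound z hz
  have hex : ∃ R, IsResolventAt A z R := ⟨R, hR⟩
  rw [resolventOp, dif_pos hex, hex.choose_spec.unique hR]
  exact hle

/-- The rays `r e^{± iψ}` with `ψ < π - θ` avoid a sector with vertex `ω < 0`. -/
theorem ray_notMem_shiftedSector {ω θ ψ ε r : ℝ} (hω : ω < 0)
    (hψ₀ : 0 < ψ) (hψ : ψ < Real.pi - θ) (hε : ε = 1 ∨ ε = -1) (hr : 0 < r) :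
    (r : ℂ) * Complex.exp ((ε * ψ : ℝ) * Complex.I) ∉ shiftedSector ω θ := by
  intro hmem
  simp only [shiftedSector, mem_ofPred_eq] at hmem
  set v : ℂ := -((r : ℂ) * Complex.exp ((ε * ψ : ℝ) * Complex.I) - (ω : ℂ)) with hv
  set β := Complex.arg v with hβ
  have hre : v.re = ω - r * Real.cos ψ := by
    rcases hε with rfl | rfl <;> simp [hv, Complex.exp_re, Complex.exp_im]
  have him : v.im = -(ε * (r * Real.sin ψ)) := by
    rcases hε with rfl | rfl <;> simp [hv, Complex.exp_re, Complex.exp_im]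
  have hθ0 : 0 < θ := (abs_nonneg _).trans_lt hmem
  have hsin : 0 < Real.sin ψ := Real.sin_pos_of_pos_of_lt_pi hψ₀ (by linarith)
  have h1 : ‖v‖ * Real.cos β = v.re := Complex.norm_mul_cos_arg v
  have h2 : ‖v‖ * Real.sin β = v.im := Complex.norm_mul_sin_arg v
  -- Multiplied by `ε`, this reads `-r sin(ψ - εβ) = ω ε sin β`. The sign of `v.im` forces `-θ < εβ
  -- < 0`, hence `0 < ψ - εβ < π`: the left side is negative and the right side is not.
  have hcross : v.im * Real.cos β = v.re * Real.sin β := by rw [← h1, ← h2]; ring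
  obtain ⟨hβ1, hβ2⟩ := abs_lt.1 hmem
  have hs : (ε * Real.sin β) ≤ 0 ∧ Real.sin (ψ - ε * β) > 0 := by
    have hvpos : 0 < ‖v‖ := norm_pos_iff.2 fun h0 => by
      have : v.im = 0 := by rw [h0]; simp
      rw [him] at this
      rcases hε with rfl | rfl <;> nlinarith [mul_pos hr hsin]
    have hneg : ε * Real.sin β < 0 := by
      have : ‖v‖ * (ε * Real.sin β) < 0 := by
        have : ‖v‖ * (ε * Real.sin β) = ε * v.im := by rw [← h2]; ring
        rw [this, him]
        rcases hε with rfl | rfl <;> nlinarith [mul_pos hr hsin]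
      by_contra hcon
      nlinarith [mul_nonneg hvpos.le (not_lt.1 hcon)]
    refine ⟨hneg.le, ?_⟩
    have hεβ : ε * β < 0 := by
      by_contra hcon
      have hnn : 0 ≤ Real.sin (ε * β) := Real.sin_nonneg_of_nonneg_of_le_pi (not_lt.1 hcon) (by
        rcases hε with rfl | rfl <;> linarith [Real.pi_pos])
      rcases hε with rfl | rfl <;> simp at hnn hneg <;> linarith
    refine Real.sin_pos_of_pos_of_lt_pi (by linarith) ?_
    rcases hε with rfl | rfl <;> linarith
  obtain ⟨hs1, hs2⟩ := hs
  rw [hre, him] at hcross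
  rw [Real.sin_sub] at hs2
  rcases hε with rfl | rfl
  · simp only [one_mul] at *
    have := mul_pos hr hs2
    nlinarith
  · simp only [neg_mul, one_mul, Real.sin_neg, Real.cos_neg] at *
    have := mul_pos hr hs2
    nlinarith

/-- Lower bound for the distance from `ω` to the ray `r e^{± iψ}`. -/
theorem le_norm_ray_sub {ω ψ ε r : ℝ} (hε : ε = 1 ∨ ε = -1) :
    |ω| * Real.sin ψ ≤ ‖(r : ℂ) * Complex.exp ((ε * ψ : ℝ) * Complex.I) - (ω : ℂ)‖ := by
  refine (le_abs_self _).trans (abs_le_of_sq_le_sq ?_ (norm_nonneg _))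
  have hre : ((r : ℂ) * Complex.exp ((ε * ψ : ℝ) * Complex.I) - (ω : ℂ)).re =
      r * Real.cos ψ - ω := by
    rcases hε with rfl | rfl <;> simp [Complex.exp_re, Complex.exp_im]
  have him : ((r : ℂ) * Complex.exp ((ε * ψ : ℝ) * Complex.I) - (ω : ℂ)).im =
      ε * (r * Real.sin ψ) := by
    rcases hε with rfl | rfl <;> simp [Complex.exp_re, Complex.exp_im]
  have hε2 : ε * ε = 1 := by rcases hε with rfl | rfl <;> norm_num
  rw [Complex.sq_norm, Complex.normSq_apply, hre, him, mul_pow, sq_abs]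
  -- Completing the square in `r` leaves the squared distance from `ω` to the line carrying the ray.
  have h1 : (r * Real.cos ψ - ω) * (r * Real.cos ψ - ω) +
      ε * (r * Real.sin ψ) * (ε * (r * Real.sin ψ)) =
      (r - ω * Real.cos ψ) ^ 2 + ω ^ 2 * Real.sin ψ ^ 2 := by
    linear_combination (r * Real.sin ψ) ^ 2 * hε2 +
      (r ^ 2 - ω ^ 2) * Real.sin_sq_add_cos_sq ψ
  rw [h1]
  exact le_add_of_nonneg_left (sq_nonneg _)

/-- Since `φ < π`, the principal logarithm on the ray is `log r ± iφ`, so the power turns the ray to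
the angle `± αφ`, where the resolvent estimate is available. -/
theorem ray_cpow {α φ ε r : ℝ} (hφ₀ : 0 < φ) (hφ : φ < Real.pi) (hε : ε = 1 ∨ ε = -1)
    (hr : 0 < r) :
    ((r : ℂ) * Complex.exp ((ε * φ : ℝ) * Complex.I)) ^ (α : ℂ) =
      ((r ^ α : ℝ) : ℂ) * Complex.exp ((ε * (α * φ) : ℝ) * Complex.I) := by
  have hlog : Complex.log ((r : ℂ) * Complex.exp ((ε * φ : ℝ) * Complex.I)) =
      (Real.log r : ℂ) + (ε * φ : ℝ) * Complex.I := by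
    rw [Complex.log_ofReal_mul hr (Complex.exp_ne_zero _), Complex.log_exp]
    · rcases hε with rfl | rfl <;> simp <;> linarith
    · rcases hε with rfl | rfl <;> simp <;> linarith
  rw [Complex.cpow_def_of_ne_zero
    (mul_ne_zero (Complex.ofReal_ne_zero.2 hr.ne') (Complex.exp_ne_zero _)), hlog,
    Real.rpow_def_of_pos hr, Complex.ofReal_exp, ← Complex.exp_add]
  congr 1
  push_cast
  ring

/-- The solution kernel along either ray of the path. -/
theorem IsSectorial.norm_solutionKernel_ray_le {A : X →ₗ.[ℂ] X} {ω θ M α φ ε r t : ℝ}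
    (hA : IsSectorial A ω θ M) (hω : ω < 0) (hα : 1 < α) (hφ₁ : Real.pi / 2 < φ)
    (hφ₂ : α * φ < Real.pi - θ) (hε : ε = 1 ∨ ε = -1) (hr : 0 < r) :
    ‖solutionKernel A α t ((r : ℂ) * Complex.exp ((ε * φ : ℝ) * Complex.I))‖ ≤
      r ^ (α - 1) * Real.exp (-(-(t * Real.cos φ) * r)) *
        (M / (|ω| * Real.sin (α * φ))) := by
  have hφ₀ : 0 < φ := by linarith [Real.pi_pos]
  have hφα : φ < α * φ := by nlinarith
  have hθ := hA.angle_pos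
  have hsin : 0 < Real.sin (α * φ) :=
    Real.sin_pos_of_pos_of_lt_pi (by linarith) (by linarith)
  have hnorm : ‖(r : ℂ) * Complex.exp ((ε * φ : ℝ) * Complex.I)‖ = r := by
    rw [norm_mul, Complex.norm_exp_ofReal_mul_I, mul_one, Complex.norm_real, Real.norm_eq_abs,
      abs_of_pos hr]
  have hre : ((r : ℂ) * Complex.exp ((ε * φ : ℝ) * Complex.I) * (t : ℂ)).re =
      -(-(t * Real.cos φ) * r) := by
    rcases hε with rfl | rfl <;> simp [Complex.exp_re, Complex.exp_im] <;> ring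
  rw [solutionKernel, norm_smul, norm_mul, Complex.norm_exp, hre,
    show ((α : ℂ) - 1) = ((α - 1 : ℝ) : ℂ) by push_cast; rfl, Complex.norm_cpow_real, hnorm,
    ray_cpow hφ₀ (by linarith) hε hr, mul_comm (Real.exp _)]
  refine mul_le_mul_of_nonneg_left ?_
    (mul_nonneg (Real.rpow_nonneg hr.le _) (Real.exp_pos _).le)
  refine (hA.norm_resolventOp_le (ray_notMem_shiftedSector hω (by linarith) hφ₂ hε
    (Real.rpow_pos_of_pos hr α))).trans ?_
  exact div_le_div_of_nonneg_left hA.const_pos.le (mul_pos (abs_pos.2 hω.ne) hsin)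
    (le_norm_ray_sub hε)

/-- The resolvent is bounded along the rays independently of `r`, because `ω` stays away from them.
What remains is the Gamma integral of `r^(α-1) e^(t r cos φ)`, which scales as `t^(-α)` since `cos φ
< 0`. -/
theorem IsSectorial.exists_norm_solutionOp_le_rpow {A : X →ₗ.[ℂ] X} {ω θ M α φ : ℝ}
    (hA : IsSectorial A ω θ M) (hω : ω < 0) (hα : 1 < α) (hφ₁ : Real.pi / 2 < φ)
    (hφ₂ : α * φ < Real.pi - θ) :
    ∃ D, 0 ≤ D ∧ ∀ t, 0 < t → ‖solutionOp A α φ t‖ ≤ D / t ^ α := by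
  have hφα : φ < α * φ := by nlinarith [Real.pi_pos]
  have hθ := hA.angle_pos
  have hcos : 0 < -Real.cos φ :=
    neg_pos.2 (Real.cos_neg_of_pi_div_two_lt_of_lt hφ₁ (by linarith))
  have hsin : 0 < Real.sin (α * φ) :=
    Real.sin_pos_of_pos_of_lt_pi (by linarith [Real.pi_pos]) (by linarith)
  set E : ℝ := M / (|ω| * Real.sin (α * φ)) with hE
  have hE0 : 0 ≤ E := div_nonneg hA.const_pos.le (mul_pos (abs_pos.2 hω.ne) hsin).le
  have hG := Real.Gamma_pos_of_pos (one_pos.trans hα)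
  refine ⟨(2 * Real.pi)⁻¹ * (2 * ((1 / -Real.cos φ) ^ α * Real.Gamma α * E)), by positivity,
    fun t ht => ?_⟩
  have hq : 0 < -(t * Real.cos φ) := by nlinarith
  have hval := Real.integral_rpow_mul_exp_neg_mul_Ioi (one_pos.trans hα) hq
  have hint : IntegrableOn (fun r : ℝ => r ^ (α - 1) * Real.exp (-(-(t * Real.cos φ) * r)))
      (Ioi 0) := by
    refine Integrable.of_integral_ne_zero ?_
    rw [hval]
    positivity
  have hray : ∀ ε : ℝ, (ε = 1 ∨ ε = -1) →
      ‖∫ r in Ioi (0 : ℝ), Complex.exp ((ε * φ : ℝ) * Complex.I) •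
        solutionKernel A α t ((r : ℂ) * Complex.exp ((ε * φ : ℝ) * Complex.I))‖ ≤
      (1 / -Real.cos φ) ^ α * Real.Gamma α * E / t ^ α := by
    intro ε hε
    refine (norm_integral_le_of_norm_le (hint.mul_const E)
      ((ae_restrict_iff' measurableSet_Ioi).2 (Eventually.of_forall fun r hr => ?_))).trans_eq ?_
    · rw [norm_smul, Complex.norm_exp_ofReal_mul_I, one_mul]
      exact hA.norm_solutionKernel_ray_le hω hα hφ₁ hφ₂ hε hr
    · rw [integral_mul_const, hval, show 1 / -(t * Real.cos φ) = (1 / -Real.cos φ) / t by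
        rw [div_div]; ring_nf, Real.div_rpow (by positivity) ht.le]
      ring
  have hplus := hray 1 (Or.inl rfl)
  have hminus := hray (-1) (Or.inr rfl)
  simp only [one_mul, neg_mul, Complex.ofReal_neg] at hplus hminus
  rw [solutionOp, if_neg ht.ne', norm_smul, wedgeIntegral]
  have hpi : ‖(2 * (Real.pi : ℂ) * Complex.I)⁻¹‖ = (2 * Real.pi)⁻¹ := by
    simp [abs_of_pos Real.pi_pos]
  rw [hpi, mul_div_assoc]
  refine mul_le_mul_of_nonneg_left ?_ (by positivity)
  refine (norm_sub_le _ _).trans ((add_le_add hplus hminus).trans_eq ?_)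
  ring

/-- The contour bound blows up at `0`; there strong continuity and Banach–Steinhaus on `[0, 1]` take
over. -/
theorem IsSectorial.exists_norm_solutionOp_le [CompleteSpace X] {A : X →ₗ.[ℂ] X} {ω θ M α φ : ℝ}
    (hA : IsSectorial A ω θ M) (hω : ω < 0) (hα : 1 < α) (hφ₁ : Real.pi / 2 < φ)
    (hφ₂ : α * φ < Real.pi - θ)
    (hS : ∀ x : X, ContinuousOn (fun t => solutionOp A α φ t x) (Ici 0)) :
    ∃ C : ℝ, 0 < C ∧
      ∀ t : ℝ, 0 ≤ t → ‖solutionOp A α φ t‖ ≤ C * M / (1 + |ω| * t ^ α) := by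
  obtain ⟨D, hD0, hD⟩ := hA.exists_norm_solutionOp_le_rpow hω hα hφ₁ hφ₂
  obtain ⟨B, hB⟩ : ∃ B, ∀ t : Icc (0 : ℝ) 1, ‖solutionOp A α φ t‖ ≤ B := by
    refine banach_steinhaus fun x => ?_
    obtain ⟨c, hc⟩ := isCompact_Icc.exists_bound_of_continuousOn
      ((hS x).mono (Icc_subset_Ici_self : Icc (0 : ℝ) 1 ⊆ Ici 0))
    exact ⟨c, fun t => hc t t.2⟩
  have hM := hA.const_pos
  have hB0 : 0 ≤ B := (norm_nonneg _).trans (hB ⟨0, by simp⟩)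
  have hα0 : 0 < α := one_pos.trans hα
  -- For `t ≤ 1` the weight `1 + |ω| t^α` is at most `1 + |ω|`; for `t ≥ 1` both `‖S‖` and `‖S‖ t^α`
  -- are at most `D`. The summand `1` only ensures positivity.
  refine ⟨(B + D + 1) * (1 + |ω|) / M, by positivity, fun t ht => ?_⟩
  have htα : 0 ≤ t ^ α := Real.rpow_nonneg ht α
  rw [div_mul_cancel₀ _ hM.ne', le_div_iff₀ (by positivity)]
  rcases le_total t 1 with h1 | h1
  · have h2 : t ^ α ≤ 1 := Real.rpow_le_one ht h1 hα0.le
    refine mul_le_mul ((hB ⟨t, ht, h1⟩).trans (by linarith)) ?_ (by positivity) (by positivity)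
    nlinarith [abs_nonneg ω]
  · have h2 : 1 ≤ t ^ α := Real.one_le_rpow h1 hα0.le
    have h3 : ‖solutionOp A α φ t‖ * t ^ α ≤ D :=
      (le_div_iff₀ (by linarith)).1 (hD t (by linarith))
    have h4 : ‖solutionOp A α φ t‖ ≤ D := by
      nlinarith [norm_nonneg (solutionOp A α φ t)]
    nlinarith [abs_nonneg ω, mul_le_mul_of_nonneg_left h3 (abs_nonneg ω)]

end Operators

/-! ### The fixed point -/

section FixedPoint

variable {X : Type*} [NormedAddCommGroup X] [NormedSpace ℂ X]

/-- Viewing `k` as the operator family `k(s) I` lets the convolution results serve the memory term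
as well as `S_α`. -/
theorem isIntegrableKernel_smul_id {k : ℝ → ℂ} (hk : IntegrableOn k (Ioi 0)) :
    IsIntegrableKernel (fun s => k s • ContinuousLinearMap.id ℂ X) (fun s => ‖k s‖) where
  meas u hu := hk.aestronglyMeasurable.smul hu.aestronglyMeasurable
  norm_le s _ := by
    rw [norm_smul]
    exact mul_le_of_le_one_right (norm_nonneg _) ContinuousLinearMap.norm_id_le
  integrable := hk.norm

theorem memoryOp_eq_kernelConv (k : ℝ → ℂ) (u : ℝ → X) :
    memoryOp k u = kernelConv (fun s => k s • ContinuousLinearMap.id ℂ X) u := by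
  funext t
  exact setIntegral_Iio_eq_kernelConv (fun s => k s • ContinuousLinearMap.id ℂ X) u t

/-- A strongly continuous family with a bounded, integrable norm bound is an integrable kernel. -/
theorem isIntegrableKernel_of_continuousOn {S : ℝ → X →L[ℂ] X} {b : ℝ → ℝ} {B : ℝ}
    (hS : ∀ x : X, ContinuousOn (fun t => S t x) (Ici 0)) (hb : ∀ s, 0 < s → ‖S s‖ ≤ b s)
    (hB : ∀ s, 0 < s → b s ≤ B) (hint : IntegrableOn b (Ioi 0)) : IsIntegrableKernel S b where
  meas u hu := by
    -- `S` is only strongly continuous, so split `S r (u r) = S r (u r - u s) + S r (u s)` and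
    -- control the first term by the uniform bound `B`.
    refine ContinuousOn.aestronglyMeasurable (fun s hs => ?_) measurableSet_Ioi
    have h1 : Tendsto (fun r => S r (u s)) (𝓝[Ioi 0] s) (𝓝 (S s (u s))) :=
      (hS (u s)).mono Ioi_subset_Ici_self s hs
    have h2 : Tendsto (fun r => S r (u r - u s)) (𝓝[Ioi 0] s) (𝓝 0) := by
      have h3 : Tendsto (fun r => B * ‖u r - u s‖) (𝓝[Ioi 0] s) (𝓝 0) := by
        have : Tendsto (fun r => B * ‖u r - u s‖) (𝓝 s) (𝓝 (B * ‖u s - u s‖)) :=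
          (by fun_prop : Continuous fun r => B * ‖u r - u s‖).tendsto s
        rw [sub_self, norm_zero, mul_zero] at this
        exact this.mono_left nhdsWithin_le_nhds
      refine squeeze_zero_norm' ?_ h3
      filter_upwards [self_mem_nhdsWithin] with r hr
      exact (S r).le_of_opNorm_le ((hb r hr).trans (hB r hr)) _
    have h4 := h2.add h1
    simp only [map_sub, sub_add_cancel, zero_add] at h4
    exact h4
  norm_le := hb
  integrable := hint

/-- The map whose fixed points are the mild solutions. -/
noncomputable def mildMap (S : ℝ → X →L[ℂ] X) (k : ℝ → ℂ) (f : ℝ → X × X → X) (u : ℝ → X) :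
    ℝ → X :=
  kernelConv S fun s => f s (u s, memoryOp k u s)

variable {S : ℝ → X →L[ℂ] X} {b : ℝ → ℝ} {k : ℝ → ℂ} {f : ℝ → X × X → X} {L : ℝ}

theorem isAAA_superposition (hk : IntegrableOn k (Ioi 0)) (hf : IsAAAParam f) (hL : 0 < L)
    (hfL : ∀ (t : ℝ) (u v x y : X), ‖f t (u, x) - f t (v, y)‖ ≤ L * (‖u - v‖ + ‖x - y‖))
    {u : ℝ → X} (hu : IsAAA u) : IsAAA fun t => f t (u t, memoryOp k u t) := by
  -- The product carries the max norm, whence the factor `2`. It is used only qualitatively; the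
  -- contraction estimate applies `hfL` directly.
  refine hf.comp (L := L * 2) (fun t y z => (hfL t y.1 z.1 y.2 z.2).trans ?_) (hu.prodMk ?_)
  · rw [mul_assoc, two_mul]
    exact mul_le_mul_of_nonneg_left (add_le_add (norm_fst_le (y - z)) (norm_snd_le (y - z))) hL.le
  · rw [memoryOp_eq_kernelConv]
    exact (isIntegrableKernel_smul_id hk).isAAA_kernelConv hu

/-- Both integrability clauses are automatic here, since `u` and its superposition are bounded and
continuous. -/
theorem isMildSolution_iff_mildMap_eq (hS : IsIntegrableKernel S b) (hk : IntegrableOn k (Ioi 0))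
    (hf : IsAAAParam f) (hL : 0 < L)
    (hfL : ∀ (t : ℝ) (u v x y : X), ‖f t (u, x) - f t (v, y)‖ ≤ L * (‖u - v‖ + ‖x - y‖))
    {u : ℝ → X} (hu : IsAAA u) : IsMildSolution S k f u ↔ mildMap S k f u = u := by
  have hfu := isAAA_superposition hk hf hL hfL hu
  obtain ⟨c, hc⟩ := hu.exists_norm_le
  obtain ⟨d, hd⟩ := hfu.exists_norm_le
  constructor
  · rintro ⟨-, -, h⟩
    funext t
    rw [h t]
    exact (setIntegral_Iio_eq_kernelConv S _ t).symm
  · refine fun h => ⟨fun t => ?_, fun t => ?_, fun t => ?_⟩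
    · exact (integrableOn_Iio_iff (fun s => k s • ContinuousLinearMap.id ℂ X) u t).2
        ((isIntegrableKernel_smul_id hk).integrableOn hu.continuous hc t)
    · exact (integrableOn_Iio_iff S (fun s => f s (u s, memoryOp k u s)) t).2
        (hS.integrableOn hfu.continuous hd t)
    · refine (congrFun h t).symm.trans ?_
      exact (setIntegral_Iio_eq_kernelConv S (fun s => f s (u s, memoryOp k u s)) t).symm

theorem norm_mildMap_sub_le (hS : IsIntegrableKernel S b) (hk : IntegrableOn k (Ioi 0))
    (hf : IsAAAParam f) (hL : 0 < L)
    (hfL : ∀ (t : ℝ) (u v x y : X), ‖f t (u, x) - f t (v, y)‖ ≤ L * (‖u - v‖ + ‖x - y‖))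
    {u v : ℝ → X} (hu : IsAAA u) (hv : IsAAA v) {e : ℝ} (he : ∀ t, ‖u t - v t‖ ≤ e) (t : ℝ) :
    ‖mildMap S k f u t - mildMap S k f v t‖ ≤
      (∫ s in Ioi (0 : ℝ), b s) * (L * (1 + ∫ s in Ioi (0 : ℝ), ‖k s‖)) * e := by
  have hfu := isAAA_superposition hk hf hL hfL hu
  have hfv := isAAA_superposition hk hf hL hfL hv
  obtain ⟨c, hc⟩ := hfu.exists_norm_le
  obtain ⟨d, hd⟩ := hfv.exists_norm_le
  obtain ⟨c', hc'⟩ := hu.exists_norm_le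
  obtain ⟨d', hd'⟩ := hv.exists_norm_le
  rw [mul_assoc]
  refine hS.norm_kernelConv_sub_le hfu.continuous hfv.continuous hc hd (fun t => ?_) t
  refine (hfL _ _ _ _ _).trans ?_
  rw [mul_assoc]
  refine mul_le_mul_of_nonneg_left ?_ hL.le
  rw [add_mul, one_mul, memoryOp_eq_kernelConv, memoryOp_eq_kernelConv]
  exact add_le_add (he t) ((isIntegrableKernel_smul_id hk).norm_kernelConv_sub_le hu.continuous
    hv.continuous hc' hd' he t)

open BoundedContinuousFunction in
theorem existsUnique_isAAA_isMildSolution [CompleteSpace X] (hS : IsIntegrableKernel S b)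
    (hk : IntegrableOn k (Ioi 0)) (hf : IsAAAParam f) (hL : 0 < L)
    (hfL : ∀ (t : ℝ) (u v x y : X), ‖f t (u, x) - f t (v, y)‖ ≤ L * (‖u - v‖ + ‖x - y‖))
    (hlt : (∫ s in Ioi (0 : ℝ), b s) * (L * (1 + ∫ s in Ioi (0 : ℝ), ‖k s‖)) < 1) :
    ∃! u : ℝ → X, IsAAA u ∧ IsMildSolution S k f u := by
  set q : ℝ := (∫ s in Ioi (0 : ℝ), b s) * (L * (1 + ∫ s in Ioi (0 : ℝ), ‖k s‖)) with hq
  have hq0 : 0 ≤ q := by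
    have h1 : 0 ≤ ∫ s in Ioi (0 : ℝ), b s := setIntegral_nonneg measurableSet_Ioi
      fun s hs => (norm_nonneg _).trans (hS.norm_le s hs)
    have h2 : 0 ≤ ∫ s in Ioi (0 : ℝ), ‖k s‖ := integral_nonneg fun _ => norm_nonneg _
    positivity
  have hmap : ∀ {u : ℝ → X}, IsAAA u → IsAAA (mildMap S k f u) := fun hu =>
    hS.isAAA_kernelConv (isAAA_superposition hk hf hL hfL hu)
  let V := {u : ℝ →ᵇ X | IsAAA u}
  have : CompleteSpace V := isClosed_setOf_isAAA.completeSpace_coe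
  have : Nonempty V := ⟨⟨0, isAAA_zero⟩⟩
  -- Uniqueness is claimed among bare functions; this promotes any competitor to a point of the
  -- complete space.
  let toV : ∀ u : ℝ → X, IsAAA u → V := fun u hu =>
    ⟨ofNormedAddCommGroup u hu.continuous hu.exists_norm_le.choose hu.exists_norm_le.choose_spec,
      hu⟩
  let Φ : V → V := fun u => toV (mildMap S k f u.1) (hmap u.2)
  have hΦ : ContractingWith ⟨q, hq0⟩ Φ := by
    refine ⟨by exact_mod_cast hlt, LipschitzWith.of_dist_le_mul fun u v => ?_⟩
    refine (BoundedContinuousFunction.dist_le (mul_nonneg hq0 dist_nonneg)).2 fun t => ?_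
    rw [dist_eq_norm]
    refine norm_mildMap_sub_le hS hk hf hL hfL u.2 v.2 (fun t => ?_) t
    rw [← dist_eq_norm]
    exact dist_coe_le_dist (f := u.1) (g := v.1) t
  refine ⟨hΦ.fixedPoint.1, ⟨hΦ.fixedPoint.2, ?_⟩, fun v ⟨hv, hmv⟩ => ?_⟩
  · refine (isMildSolution_iff_mildMap_eq hS hk hf hL hfL hΦ.fixedPoint.2).2 ?_
    exact congrArg (fun w : V => (w.1 : ℝ → X)) hΦ.fixedPoint_isFixedPt
  · have hfix : Φ (toV v hv) = toV v hv := Subtype.ext (DFunLike.coe_injective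
      ((isMildSolution_iff_mildMap_eq hS hk hf hL hfL hv).1 hmv))
    exact congrArg (fun w : V => (w.1 : ℝ → X)) (hΦ.fixedPoint_unique hfix)

end FixedPoint

theorem theorem3p3 {X : Type*} [NormedAddCommGroup X] [NormedSpace ℂ X] [CompleteSpace X]
    (α : ℝ) (hα₁ : 1 < α) (hα₂ : α < 2)
    (A : X →ₗ.[ℂ] X) (hdense : Dense (A.domain : Set X))
    (ω θ M : ℝ) (hω : ω < 0) (hA : IsSectorial A ω θ M)
    (hθ : θ < Real.pi * (1 - α / 2))
    -- the half-opening angle of the integration path of `S_α`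
    (φ : ℝ) (hφ₁ : Real.pi / 2 < φ) (hφ₂ : α * φ < Real.pi - θ)
    (hS : ∀ x : X, ContinuousOn (fun t => solutionOp A α φ t x) (Set.Ici 0)) :
    (∃ C : ℝ, 0 < C ∧
      ∀ t : ℝ, 0 ≤ t → ‖solutionOp A α φ t‖ ≤ C * M / (1 + |ω| * t ^ α)) ∧
    ∀ C : ℝ, 0 < C →
      (∀ t : ℝ, 0 ≤ t → ‖solutionOp A α φ t‖ ≤ C * M / (1 + |ω| * t ^ α)) →
      ∀ (k : ℝ → ℂ), MeasureTheory.IntegrableOn k (Set.Ioi 0) →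
      ∀ (f : ℝ → X × X → X), IsAAAParam f →
      ∀ (L : ℝ), 0 < L →
        (∀ (t : ℝ) (u v x y : X), ‖f t (u, x) - f t (v, y)‖ ≤ L * (‖u - v‖ + ‖x - y‖)) →
        C * M * |ω| ^ (-(1 / α)) * Real.pi / (α * Real.sin (Real.pi / α))
          * (L * (1 + ∫ s in Set.Ioi (0 : ℝ), ‖k s‖)) < 1 →
        ∃! u : ℝ → X, IsAAA u ∧ IsMildSolution (solutionOp A α φ) k f u := by
  refine ⟨hA.exists_norm_solutionOp_le hω hα₁ hφ₁ hφ₂ hS, ?_⟩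
  intro C hC hbound k hk f hf L hL hfL hlt
  have hw : 0 < |ω| := abs_pos.2 hω.ne
  have hCM : 0 < C * M := mul_pos hC hA.const_pos
  have hkernel : IsIntegrableKernel (solutionOp A α φ)
      (fun t => C * M * (1 / (1 + |ω| * t ^ α))) := by
    refine isIntegrableKernel_of_continuousOn (B := C * M) hS (fun t ht => ?_) (fun t ht => ?_)
      ((integrableOn_one_div_one_add_mul_rpow hα₁ hw).const_mul _)
    · rw [mul_one_div]
      exact hbound t ht.le
    · have htα := Real.rpow_nonneg ht.le α
      refine mul_le_of_le_one_right hCM.le ((div_le_one (by positivity)).2 ?_)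
      linarith [mul_nonneg hw.le htα]
  refine existsUnique_isAAA_isMildSolution hkernel hk hf hL hfL (lt_of_eq_of_lt ?_ hlt)
  rw [integral_const_mul, integral_one_div_one_add_mul_rpow hα₁ hw]
  ring
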